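/- Let $C$ be a small category, regarded as the set of its arrows: an arrow $a$ runs from its domain $\mathbf{d}(a)$ to its codomain $\mathbf{r}(a)$, the product $ab$ is defined when $\mathbf{d}(a)=\mathbf{r}(b)$, and identities are identified with objects. For $X\subseteq C$ put $XC=\{xs : x\in X,\ s\in C,\ xs \text{ defined}\}$ and $aC=\{a\}C$. A right ideal is finitely generated if it equals $XC$ for a finite (possibly empty) set $X$. Arrows $a,b$ are *incomparable* (independent) if $aC\cap bC=\varnothing$, and a *code* is a finite set of pairwise independent arrows. $C$ is *strongly finitely aligned* if every non-empty intersection $aC\cap bC$ equals $XC$ for some code $X$. $C$ is a *higher rank graph* ($k$-graph) if it is countable and equipped with a functor $d:C\to\mathbb{N}^k$ such that whenever $d(a)=\mathbf{m}+\mathbf{n}$ there are unique $a_1,a_2\in C$ with $a=a_1a_2$, $d(a_1)=\mathbf{m}$, $d(a_2)=\mathbf{n}$. It has *no sources* if for each identity $e$ and each $\mathbf{m}\in\mathbb{N}^k$ there is an arrow $x$ with $\mathbf{r}(x)=e$ and $d(x)=\mathbf{m}$; it is *row finite* if for each identity $e$ and each $\mathbf{m}$ there are only finitely many such $x$. It is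 *aperiodic* if for all $a\neq b$ in $C$ with $\mathbf{d}(a)=\mathbf{d}(b)$ there is $u\in C$ such that $au$ and $bu$ are defined and incomparable. If $C$ is strongly finitely aligned and has finitely many identities, let $\mathsf{R}(C)$ be the inverse monoid (under composition of partial functions) of all bijections $\theta:R_1\to R_2$ between finitely generated right ideals of $C$ with $\theta(rs)=\theta(r)s$ for all $r\in R_1$ and $s\in C$ with $rs$ defined. Its zero is the empty function and its natural partial order is $a\le b \iff a=ba^{-1}a$. Let $\equiv$ be the Lenz congruence on $\mathsf{R}(C)$: $s\equiv t$ iff for every $0\ne x\le s$ there is $z\neq 0$ with $z\le x$ and $z\le t$, and for every $0\neq y\le t$ there is $z\ne 0$ with $z\le y$ and $z\le s$. Put $\mathsf{B}(C)=\mathsf{R}(C)/{\equiv}$. An inverse semigroup is *fundamental* if the only elements commuting with all idempotents are themselves idempotents. **Theorem.** Let $C$ be a strongly finitely aligned higher rank graph with a finite number of identities which has no sources and is row finite. Then the following are equivalent: 1. $\mathsf{B}(C)$ is fundamental. 2. $C$ is aperiodic. -/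

import Mathlib

open CategoryTheory

namespace HigherRank

/-! ### Inverse monoids with zero -/

/-- A monoid with zero in which every element `a` has a unique `b` with `a = a b a` and
`b = b a b`; this `b` is `a⁻¹`. -/
class InverseMonoidWithZero (S : Type*) extends MonoidWithZero S, Inv S where
  mul_inv_mul : ∀ a : S, a * a⁻¹ * a = a
  inv_mul_inv : ∀ a : S, a⁻¹ * a * a⁻¹ = a⁻¹
  inv_unique : ∀ a b : S, a * b * a = a → b * a * b = b → b = a⁻¹

/-- The only elements that commute with all idempotents are themselves idempotents. -/
def IsFundamental (S : Type*) [Mul S] : Prop :=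
  ∀ a : S, (∀ e : S, IsIdempotentElem e → Commute a e) → IsIdempotentElem a

section InverseMonoid

variable {S : Type*} [InverseMonoidWithZero S]

open InverseMonoidWithZero

/-- The natural partial order. -/
def NatLE (a b : S) : Prop := a = b * a⁻¹ * a

/-- The Lenz relation `s ≡ t`: below every non-zero `x ≤ s` there is a non-zero element that is
also below `t`, and symmetrically. -/
def Lenz (s t : S) : Prop :=
  (∀ x : S, x ≠ 0 → NatLE x s → ∃ z : S, z ≠ 0 ∧ NatLE z x ∧ NatLE z t) ∧
  (∀ y : S, y ≠ 0 → NatLE y t → ∃ z : S, z ≠ 0 ∧ NatLE z y ∧ NatLE z s)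

theorem inv_inv_eq (a : S) : a⁻¹⁻¹ = a :=
  (InverseMonoidWithZero.inv_unique a⁻¹ a (inv_mul_inv a) (mul_inv_mul a)).symm

theorem inv_of_idem {e : S} (he : e * e = e) : e⁻¹ = e :=
  (InverseMonoidWithZero.inv_unique e e (by rw [he, he]) (by rw [he, he])).symm

theorem mul_idem {e f : S} (he : e * e = e) (hf : f * f = f) : e * f * (e * f) = e * f := by
  have h1 := mul_inv_mul (e * f)
  have h2 := inv_mul_inv (e * f)
  set x := (e * f)⁻¹ with hx
  have h3 : f * x * e = x := by
    apply InverseMonoidWithZero.inv_unique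
    · calc e * f * (f * x * e) * (e * f) = e * (f * f) * x * (e * e) * f := by
            simp only [mul_assoc]
        _ = e * f * x * (e * f) := by rw [he, hf]; simp only [mul_assoc]
        _ = e * f := h1
    · calc f * x * e * (e * f) * (f * x * e) = f * x * (e * e) * (f * f) * x * e := by
            simp only [mul_assoc]
        _ = f * (x * (e * f) * x) * e := by rw [he, hf]; simp only [mul_assoc]
        _ = f * x * e := by rw [h2]
  have h4 : x * x = x := by
    calc x * x = (f * x * e) * (f * x * e) := by rw [h3]
      _ = f * (x * (e * f) * x) * e := by simp only [mul_assoc]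
      _ = x := by rw [h2, h3]
  have h5 : e * f = x := by
    have := InverseMonoidWithZero.inv_unique x (e * f) h2 h1
    rw [this, inv_of_idem h4]
  rw [h5, h4]

theorem idem_comm {e f : S} (he : e * e = e) (hf : f * f = f) : e * f = f * e := by
  have hef := mul_idem he hf
  have hfe := mul_idem hf he
  have h : f * e = (e * f)⁻¹ := by
    apply InverseMonoidWithZero.inv_unique
    · calc e * f * (f * e) * (e * f) = e * (f * f) * (e * e) * f := by simp only [mul_assoc]
        _ = e * f * (e * f) := by rw [he, hf]; simp only [mul_assoc]
        _ = e * f := hef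
    · calc f * e * (e * f) * (f * e) = f * (e * e) * (f * f) * e := by simp only [mul_assoc]
        _ = f * e * (f * e) := by rw [he, hf]; simp only [mul_assoc]
        _ = f * e := hfe
  rw [h, inv_of_idem hef]

theorem idem_inv_mul (a : S) : a⁻¹ * a * (a⁻¹ * a) = a⁻¹ * a := by
  rw [← mul_assoc, inv_mul_inv]

theorem idem_mul_inv (a : S) : a * a⁻¹ * (a * a⁻¹) = a * a⁻¹ := by
  rw [← mul_assoc, mul_inv_mul]

theorem mul_inv_eq (a b : S) : (a * b)⁻¹ = b⁻¹ * a⁻¹ := by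
  symm
  apply InverseMonoidWithZero.inv_unique
  · calc a * b * (b⁻¹ * a⁻¹) * (a * b) = a * ((b * b⁻¹) * (a⁻¹ * a)) * b := by
          simp only [mul_assoc]
      _ = (a * a⁻¹ * a) * (b * b⁻¹ * b) := by
          rw [idem_comm (idem_mul_inv b) (idem_inv_mul a)]; simp only [mul_assoc]
      _ = a * b := by rw [mul_inv_mul, mul_inv_mul]
  · calc b⁻¹ * a⁻¹ * (a * b) * (b⁻¹ * a⁻¹) = b⁻¹ * ((a⁻¹ * a) * (b * b⁻¹)) * a⁻¹ := by
          simp only [mul_assoc]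
      _ = (b⁻¹ * b * b⁻¹) * (a⁻¹ * a * a⁻¹) := by
          rw [← idem_comm (idem_mul_inv b) (idem_inv_mul a)]; simp only [mul_assoc]
      _ = b⁻¹ * a⁻¹ := by rw [inv_mul_inv, inv_mul_inv]

theorem inv_zero_eq : (0 : S)⁻¹ = 0 := inv_of_idem (mul_zero 0)

theorem natLE_refl (a : S) : NatLE a a := (mul_inv_mul a).symm

/-- `b e ≤ b` for every idempotent `e`. -/
theorem natLE_of_eq_mul_idem {a b e : S} (he : e * e = e) (h : a = b * e) : NatLE a b := by
  unfold NatLE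
  subst h
  rw [mul_inv_eq, inv_of_idem he]
  calc b * e = (b * b⁻¹ * b) * (e * e) := by rw [mul_inv_mul, he]
    _ = b * ((b⁻¹ * b) * e) * e := by simp only [mul_assoc]
    _ = b * (e * b⁻¹) * (b * e) := by
      rw [idem_comm (idem_inv_mul b) he]; simp only [mul_assoc]

/-- `e b ≤ b` for every idempotent `e`. -/
theorem natLE_of_eq_idem_mul {a b e : S} (he : e * e = e) (h : a = e * b) : NatLE a b := by
  have hidem : (b⁻¹ * e * b) * (b⁻¹ * e * b) = b⁻¹ * e * b := by
    calc (b⁻¹ * e * b) * (b⁻¹ * e * b) = b⁻¹ * (e * (b * b⁻¹)) * e * b := by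
          simp only [mul_assoc]
      _ = (b⁻¹ * b * b⁻¹) * (e * e) * b := by
          rw [idem_comm he (idem_mul_inv b)]; simp only [mul_assoc]
      _ = b⁻¹ * e * b := by rw [inv_mul_inv, he]
  refine natLE_of_eq_mul_idem hidem ?_
  calc a = e * (b * b⁻¹ * b) := by rw [mul_inv_mul, h]
    _ = (e * (b * b⁻¹)) * b := by simp only [mul_assoc]
    _ = b * (b⁻¹ * e * b) := by rw [idem_comm he (idem_mul_inv b)]; simp only [mul_assoc]

theorem NatLE.eq_mul_idem {a b : S} (h : NatLE a b) : a = b * (a⁻¹ * a) := by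
  rw [← mul_assoc]; exact h

theorem NatLE.inv {a b : S} (h : NatLE a b) : NatLE a⁻¹ b⁻¹ := by
  refine natLE_of_eq_idem_mul (idem_inv_mul a) ?_
  conv_lhs => rw [h.eq_mul_idem]
  rw [mul_inv_eq, inv_of_idem (idem_inv_mul a)]

theorem NatLE.eq_idem_mul {a b : S} (h : NatLE a b) : a = (a * a⁻¹) * b := by
  have := h.inv.eq_mul_idem
  rw [inv_inv_eq] at this
  have h2 := congrArg (fun x => x⁻¹) this
  simpa only [mul_inv_eq, inv_inv_eq] using h2

theorem NatLE.trans {a b c : S} (h : NatLE a b) (h' : NatLE b c) : NatLE a c := by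
  refine natLE_of_eq_mul_idem (mul_idem (idem_inv_mul b) (idem_inv_mul a)) ?_
  rw [← mul_assoc, ← h'.eq_mul_idem]
  exact h.eq_mul_idem

theorem NatLE.mul_right {a b : S} (h : NatLE a b) (c : S) : NatLE (a * c) (b * c) := by
  refine natLE_of_eq_idem_mul (idem_mul_inv a) ?_
  rw [← mul_assoc, ← h.eq_idem_mul]

theorem NatLE.mul_left {a b : S} (h : NatLE a b) (c : S) : NatLE (c * a) (c * b) := by
  refine natLE_of_eq_mul_idem (idem_inv_mul a) ?_
  rw [mul_assoc, ← h.eq_mul_idem]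

theorem inv_eq_zero_iff {a : S} : a⁻¹ = 0 ↔ a = 0 := by
  constructor
  · intro h
    rw [← inv_inv_eq a, h, inv_zero_eq]
  · rintro rfl
    exact inv_zero_eq

theorem lenz_refl (s : S) : Lenz s s :=
  ⟨fun x hx h => ⟨x, hx, natLE_refl x, h⟩, fun x hx h => ⟨x, hx, natLE_refl x, h⟩⟩

theorem Lenz.symm {s t : S} (h : Lenz s t) : Lenz t s := ⟨h.2, h.1⟩

theorem Lenz.trans {s t u : S} (h : Lenz s t) (h' : Lenz t u) : Lenz s u := by
  constructor
  · intro x hx hxs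
    obtain ⟨z, hz, hzx, hzt⟩ := h.1 x hx hxs
    obtain ⟨w, hw, hwz, hwu⟩ := h'.1 z hz hzt
    exact ⟨w, hw, hwz.trans hzx, hwu⟩
  · intro x hx hxs
    obtain ⟨z, hz, hzx, hzt⟩ := h'.2 x hx hxs
    obtain ⟨w, hw, hwz, hwu⟩ := h.2 z hz hzt
    exact ⟨w, hw, hwz.trans hzx, hwu⟩

theorem Lenz.inv {s t : S} (h : Lenz s t) : Lenz s⁻¹ t⁻¹ := by
  have key : ∀ {s t : S}, Lenz s t → ∀ x : S, x ≠ 0 → NatLE x s⁻¹ →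
      ∃ z : S, z ≠ 0 ∧ NatLE z x ∧ NatLE z t⁻¹ := by
    intro s t h x hx hxs
    have h1 := hxs.inv
    rw [inv_inv_eq] at h1
    obtain ⟨z, hz, hzx, hzt⟩ := h.1 x⁻¹ (fun h0 => hx (inv_eq_zero_iff.1 h0)) h1
    have h2 := hzx.inv
    rw [inv_inv_eq] at h2
    exact ⟨z⁻¹, fun h0 => hz (inv_eq_zero_iff.1 h0), h2, hzt.inv⟩
  exact ⟨key h, key h.symm⟩

theorem Lenz.mul_right {s t : S} (h : Lenz s t) (u : S) : Lenz (s * u) (t * u) := by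
  have key : ∀ {s t : S}, Lenz s t → ∀ x : S, x ≠ 0 → NatLE x (s * u) →
      ∃ z : S, z ≠ 0 ∧ NatLE z x ∧ NatLE z (t * u) := by
    intro s t h x hx hxs
    have hxu : x * (u⁻¹ * u) = x := by
      conv_rhs => rw [hxs.eq_idem_mul]
      conv_lhs => rw [hxs.eq_idem_mul]
      calc x * x⁻¹ * (s * u) * (u⁻¹ * u) = x * x⁻¹ * (s * (u * u⁻¹ * u)) := by
            simp only [mul_assoc]
        _ = x * x⁻¹ * (s * u) := by rw [mul_inv_mul]
    have hy0 : x * u⁻¹ ≠ 0 := by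
      intro h0
      apply hx
      rw [← hxu, ← mul_assoc, h0, zero_mul]
    have hys : NatLE (x * u⁻¹) s := by
      refine (hxs.mul_right u⁻¹).trans (natLE_of_eq_mul_idem (idem_mul_inv u) ?_)
      rw [mul_assoc]
    obtain ⟨z, hz, hzy, hzt⟩ := h.1 _ hy0 hys
    refine ⟨z * u, ?_, ?_, hzt.mul_right u⟩
    · intro h0
      apply hz
      have hzu : z * (u * u⁻¹) = z := by
        conv_rhs => rw [hzy.eq_idem_mul]
        conv_lhs => rw [hzy.eq_idem_mul]
        calc z * z⁻¹ * (x * u⁻¹) * (u * u⁻¹) = z * z⁻¹ * (x * (u⁻¹ * u * u⁻¹)) := by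
              simp only [mul_assoc]
          _ = z * z⁻¹ * (x * u⁻¹) := by rw [inv_mul_inv]
      rw [← hzu, ← mul_assoc, h0, zero_mul]
    · have := hzy.mul_right u
      rwa [mul_assoc, hxu] at this
  exact ⟨key h, key h.symm⟩

theorem Lenz.mul_left {s t : S} (h : Lenz s t) (u : S) : Lenz (u * s) (u * t) := by
  have := (h.inv.mul_right u⁻¹).inv
  simpa only [mul_inv_eq, inv_inv_eq] using this

variable (S) in
/-- The Lenz congruence. -/
def lenzCon : Con S where
  r := Lenz
  iseqv := ⟨lenz_refl, Lenz.symm, Lenz.trans⟩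
  mul' := fun {_ x y _} h h' => (h.mul_right y).trans (h'.mul_left x)

/-- Uniqueness of inverses from equational axioms. -/
theorem inverse_unique_of_equations {T : Type*} [Semigroup T] [Inv T]
    (h1 : ∀ a : T, a * a⁻¹ * a = a) (h2 : ∀ a : T, a⁻¹ * a * a⁻¹ = a⁻¹)
    (h3 : ∀ a b : T, (a * b)⁻¹ = b⁻¹ * a⁻¹)
    (h4 : ∀ a b : T, a * a⁻¹ * (b⁻¹ * b) = b⁻¹ * b * (a * a⁻¹))
    (a b : T) (hab : a * b * a = a) (hba : b * a * b = b) : b = a⁻¹ := by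
  have hinv : ∀ e : T, e * e = e → e⁻¹ = e := by
    intro e he
    have he' : e⁻¹ * e⁻¹ = e⁻¹ := by rw [← h3, he]
    calc e⁻¹ = e⁻¹ * (e * e) * e⁻¹ := by rw [he, h2]
      _ = e⁻¹ * e * (e * e⁻¹) := by simp only [mul_assoc]
      _ = e * e⁻¹ * (e⁻¹ * e) := by rw [h4]
      _ = e * (e⁻¹ * e⁻¹) * e := by simp only [mul_assoc]
      _ = e := by rw [he', h1]
  have hcomm : ∀ e f : T, e * e = e → f * f = f → e * f = f * e := by
    intro e f he hf
    have := h4 e f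
    rwa [hinv e he, hinv f hf, he, hf] at this
  have i1 : (a * b) * (a * b) = a * b := by rw [← mul_assoc, hab]
  have i2 : (b * a) * (b * a) = b * a := by rw [← mul_assoc, hba]
  have i3 : (a * a⁻¹) * (a * a⁻¹) = a * a⁻¹ := by rw [← mul_assoc, h1]
  have i4 : (a⁻¹ * a) * (a⁻¹ * a) = a⁻¹ * a := by rw [← mul_assoc, h2]
  symm
  calc a⁻¹ = a⁻¹ * (a * b * a) * a⁻¹ := by rw [hab, h2]
    _ = (a⁻¹ * a) * (b * a) * a⁻¹ := by simp only [mul_assoc]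
    _ = (b * a) * (a⁻¹ * a) * a⁻¹ := by rw [hcomm _ _ i4 i2]
    _ = b * (a * a⁻¹ * a) * a⁻¹ := by simp only [mul_assoc]
    _ = (b * a * b) * a * a⁻¹ := by rw [h1, hba]
    _ = b * ((a * b) * (a * a⁻¹)) := by simp only [mul_assoc]
    _ = b * ((a * a⁻¹) * (a * b)) := by rw [hcomm _ _ i1 i3]
    _ = b * (a * a⁻¹ * a) * b := by simp only [mul_assoc]
    _ = b := by rw [h1, hba]

variable (S) in
/-- The quotient `S/≡` by the Lenz congruence. -/
def LenzQuotient : Type _ := (lenzCon S).Quotient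

instance : InverseMonoidWithZero (LenzQuotient S) :=
  letI m : Monoid (LenzQuotient S) := inferInstanceAs (Monoid (lenzCon S).Quotient)
  letI i : Inv (LenzQuotient S) :=
    ⟨Quotient.map' (fun a : S => a⁻¹) (fun _ _ h => Lenz.inv h)⟩
  { m, i with
    zero := ((0 : S) : (lenzCon S).Quotient)
    zero_mul := by
      rintro ⟨a⟩
      exact congrArg ((↑) : S → (lenzCon S).Quotient) (zero_mul a)
    mul_zero := by
      rintro ⟨a⟩
      exact congrArg ((↑) : S → (lenzCon S).Quotient) (mul_zero a)
    mul_inv_mul := by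
      rintro ⟨a⟩
      exact congrArg ((↑) : S → (lenzCon S).Quotient) (mul_inv_mul a)
    inv_mul_inv := by
      rintro ⟨a⟩
      exact congrArg ((↑) : S → (lenzCon S).Quotient) (inv_mul_inv a)
    inv_unique := by
      refine inverse_unique_of_equations ?_ ?_ ?_ ?_
      · rintro ⟨a⟩
        exact congrArg ((↑) : S → (lenzCon S).Quotient) (mul_inv_mul a)
      · rintro ⟨a⟩
        exact congrArg ((↑) : S → (lenzCon S).Quotient) (inv_mul_inv a)
      · rintro ⟨a⟩ ⟨b⟩
        exact congrArg ((↑) : S → (lenzCon S).Quotient) (mul_inv_eq a b)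
      · rintro ⟨a⟩ ⟨b⟩
        exact congrArg ((↑) : S → (lenzCon S).Quotient)
          (idem_comm (idem_mul_inv a) (idem_inv_mul b)) }

end InverseMonoid

/-! ### Categories as sets of arrows -/

universe v u

/-- The arrows of a category; `a` runs from its domain `a.dom` to its codomain `a.cod`.
The identities of the category are identified with its objects. -/
structure Arr (V : Type u) [Category.{v} V] where
  {dom cod : V}
  hom : dom ⟶ cod

section Arrows

variable {V : Type u} [Category.{v} V]

/-- `IsProd a b c`: the product `ab` (first `b`, then `a`) is defined, that is, the domain of `a`
is the codomain of `b`, and it equals `c`. -/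
inductive IsProd : Arr V → Arr V → Arr V → Prop
  | mk {x y z : V} (a : y ⟶ z) (b : x ⟶ y) : IsProd ⟨a⟩ ⟨b⟩ ⟨b ≫ a⟩

/-- The right ideal `XC`. -/
def rightIdeal (X : Set (Arr V)) : Set (Arr V) := {c | ∃ x ∈ X, ∃ s, IsProd x s c}

/-- A finitely generated right ideal (possibly empty). -/
def IsFGRightIdeal (A : Set (Arr V)) : Prop := ∃ X : Set (Arr V), X.Finite ∧ A = rightIdeal X

/-- `aC ∩ bC = ∅`. -/
def Independent (a b : Arr V) : Prop := rightIdeal {a} ∩ rightIdeal {b} = ∅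

/-- A code: a finite set of pairwise independent arrows. -/
def IsCode (X : Set (Arr V)) : Prop := X.Finite ∧ X.Pairwise Independent

variable (V) in
/-- Every intersection `aC ∩ bC` is finitely generated. -/
class FinitelyAligned : Prop where
  fg_inter : ∀ a b : Arr V, IsFGRightIdeal (rightIdeal {a} ∩ rightIdeal {b})

variable (V) in
/-- Every non-empty intersection `aC ∩ bC` is generated by a code. -/
class StronglyFinitelyAligned : Prop where
  code_inter : ∀ a b : Arr V, (rightIdeal {a} ∩ rightIdeal {b}).Nonempty →
    ∃ X : Set (Arr V), IsCode X ∧ rightIdeal {a} ∩ rightIdeal {b} = rightIdeal X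

instance [StronglyFinitelyAligned V] : FinitelyAligned V where
  fg_inter a b := by
    rcases Set.eq_empty_or_nonempty (rightIdeal {a} ∩ rightIdeal {b}) with h | h
    · exact ⟨∅, Set.finite_empty, by rw [h]; ext; simp [rightIdeal]⟩
    · obtain ⟨X, hX, e⟩ := StronglyFinitelyAligned.code_inter a b h
      exact ⟨X, hX.1, e⟩

theorem IsProd.unique {a b c c' : Arr V} (h : IsProd a b c) (h' : IsProd a b c') : c = c' := by
  cases h; cases h'; rfl

theorem isProd_id (a : Arr V) : IsProd a ⟨𝟙 a.dom⟩ a := by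
  have := IsProd.mk a.hom (𝟙 a.dom)
  rwa [Category.id_comp] at this

theorem id_isProd (a : Arr V) : IsProd ⟨𝟙 a.cod⟩ a a := by
  have := IsProd.mk (𝟙 a.cod) a.hom
  rwa [Category.comp_id] at this

theorem IsProd.dom_eq {a b c : Arr V} (h : IsProd a b c) : a.dom = b.cod := by
  cases h; rfl

theorem exists_isProd {a b : Arr V} (h : a.dom = b.cod) : ∃ c, IsProd a b c := by
  obtain ⟨f⟩ := a
  obtain ⟨g⟩ := b
  dsimp at h
  subst h
  exact ⟨_, .mk f g⟩

theorem IsProd.assoc {a b ab c abc : Arr V} (h : IsProd a b ab) (h' : IsProd ab c abc) :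
    ∃ bc, IsProd b c bc ∧ IsProd a bc abc := by
  cases h with
  | mk f g =>
    cases h' with
    | mk _ k =>
      refine ⟨⟨k ≫ g⟩, .mk g k, ?_⟩
      rw [← Category.assoc]
      exact .mk f (k ≫ g)

/-! ### Bijective morphisms between finitely generated right ideals -/

/-- The domain of definition of a partial bijection. -/
def pdom (θ : PEquiv (Arr V) (Arr V)) : Set (Arr V) := {a | ∃ b, b ∈ θ a}

/-- `θ(rs) = θ(r)s` for all `r` in the domain of definition and all `s` with `rs` defined. -/
def IsMorphism (θ : PEquiv (Arr V) (Arr V)) : Prop :=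
  ∀ r s t r' : Arr V, IsProd r s t → r' ∈ θ r → ∃ t', t' ∈ θ t ∧ IsProd r' s t'

variable (V) in
/-- `R(C)`: the bijective morphisms between finitely generated right ideals of `C`, as partial
bijections of the set of arrows. -/
def R : Type (max u v) :=
  {θ : PEquiv (Arr V) (Arr V) // IsMorphism θ ∧ IsFGRightIdeal (pdom θ) ∧
    IsFGRightIdeal (pdom θ.symm)}

theorem IsMorphism.dom_eq {θ : PEquiv (Arr V) (Arr V)} (h : IsMorphism θ) {r r' : Arr V}
    (hr : r' ∈ θ r) : r'.dom = r.dom := by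
  obtain ⟨t', -, ht⟩ := h r _ r r' (isProd_id r) hr
  exact ht.dom_eq

theorem IsMorphism.symm {θ : PEquiv (Arr V) (Arr V)} (h : IsMorphism θ) :
    IsMorphism θ.symm := by
  intro r s t r' hp hr
  rw [PEquiv.mem_iff_mem] at hr
  obtain ⟨t', ht'⟩ := exists_isProd (a := r') (b := s) (by rw [← h.dom_eq hr, hp.dom_eq])
  obtain ⟨t'', h1, h2⟩ := h r' s t' r ht' hr
  obtain rfl := hp.unique h2
  exact ⟨t', (PEquiv.mem_iff_mem θ).2 h1, ht'⟩

theorem IsMorphism.trans {θ φ : PEquiv (Arr V) (Arr V)} (h : IsMorphism θ) (h' : IsMorphism φ) :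
    IsMorphism (θ.trans φ) := by
  intro r s t r' hp hr
  rw [PEquiv.mem_trans] at hr
  obtain ⟨q, hq, hq'⟩ := hr
  obtain ⟨t1, ht1, hp1⟩ := h r s t q hp hq
  obtain ⟨t2, ht2, hp2⟩ := h' q s t1 r' hp1 hq'
  exact ⟨t2, (PEquiv.mem_trans _ _ _ _).2 ⟨t1, ht1, ht2⟩, hp2⟩

theorem subset_rightIdeal (X : Set (Arr V)) : X ⊆ rightIdeal X :=
  fun x hx => ⟨x, hx, _, isProd_id x⟩

theorem IsFGRightIdeal.inter [FinitelyAligned V] {A B : Set (Arr V)} (hA : IsFGRightIdeal A)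
    (hB : IsFGRightIdeal B) : IsFGRightIdeal (A ∩ B) := by
  obtain ⟨X, hX, rfl⟩ := hA
  obtain ⟨Y, hY, rfl⟩ := hB
  choose Z hZ hZ' using fun a b : Arr V => FinitelyAligned.fg_inter a b
  refine ⟨⋃ x ∈ X, ⋃ y ∈ Y, Z x y, hX.biUnion fun x _ => hY.biUnion fun y _ => hZ x y, ?_⟩
  ext c
  constructor
  · rintro ⟨⟨x, hx, s, hs⟩, ⟨y, hy, t, ht⟩⟩
    have hc : c ∈ rightIdeal {x} ∩ rightIdeal {y} := ⟨⟨x, rfl, s, hs⟩, ⟨y, rfl, t, ht⟩⟩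
    rw [hZ'] at hc
    obtain ⟨z, hz, w, hw⟩ := hc
    exact ⟨z, by simp only [Set.mem_iUnion]; exact ⟨x, hx, y, hy, hz⟩, w, hw⟩
  · rintro ⟨z, hz, w, hw⟩
    simp only [Set.mem_iUnion] at hz
    obtain ⟨x, hx, y, hy, hz⟩ := hz
    have hc : c ∈ rightIdeal (Z x y) := ⟨z, hz, w, hw⟩
    rw [← hZ'] at hc
    obtain ⟨⟨_, rfl, s, hs⟩, ⟨_, rfl, t, ht⟩⟩ := hc
    exact ⟨⟨_, hx, s, hs⟩, ⟨_, hy, t, ht⟩⟩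

/-- The image of a finitely generated right ideal under a morphism. -/
theorem IsFGRightIdeal.image {θ : PEquiv (Arr V) (Arr V)} (h : IsMorphism θ) {A : Set (Arr V)}
    (hA : IsFGRightIdeal A) (hsub : A ⊆ pdom θ) : IsFGRightIdeal {b | ∃ a ∈ A, b ∈ θ a} := by
  obtain ⟨X, hX, rfl⟩ := hA
  have hfin : {b | ∃ a ∈ X, b ∈ θ a}.Finite := by
    refine Set.Finite.subset (hX.biUnion (t := fun a => {b | b ∈ θ a}) fun a _ => ?_) ?_
    · refine Set.Subsingleton.finite fun b hb c hc => ?_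
      exact Option.mem_unique hb hc
    · rintro b ⟨a, ha, hb⟩
      simp only [Set.mem_iUnion]
      exact ⟨a, ha, hb⟩
  refine ⟨_, hfin, ?_⟩
  ext b
  constructor
  · rintro ⟨c, ⟨x, hx, s, hs⟩, hb⟩
    obtain ⟨x', hx'⟩ := hsub (subset_rightIdeal X hx)
    obtain ⟨t', ht', hp⟩ := h x s c x' hs hx'
    obtain rfl := Option.mem_unique hb ht'
    exact ⟨x', ⟨x, hx, hx'⟩, s, hp⟩
  · rintro ⟨x', ⟨x, hx, hx'⟩, s, hp⟩
    obtain ⟨t, ht⟩ := exists_isProd (a := x) (b := s) (by rw [← h.dom_eq hx', hp.dom_eq])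
    obtain ⟨t', ht', hp'⟩ := h x s t x' ht hx'
    obtain rfl := hp.unique hp'
    exact ⟨t, ⟨x, hx, s, ht⟩, ht'⟩

theorem pdom_trans_fg [FinitelyAligned V] {θ φ : PEquiv (Arr V) (Arr V)} (h : IsMorphism θ)
    (hθ : IsFGRightIdeal (pdom θ.symm)) (hφ : IsFGRightIdeal (pdom φ)) :
    IsFGRightIdeal (pdom (θ.trans φ)) := by
  have := (hθ.inter hφ).image h.symm Set.inter_subset_left
  convert this using 1
  ext a
  constructor
  · rintro ⟨c, hc⟩
    rw [PEquiv.mem_trans] at hc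
    obtain ⟨b, hb, hc⟩ := hc
    have hb' := (PEquiv.mem_iff_mem θ).2 hb
    exact ⟨b, ⟨⟨a, hb'⟩, ⟨c, hc⟩⟩, hb'⟩
  · rintro ⟨b, ⟨-, ⟨c, hc⟩⟩, hb⟩
    exact ⟨c, (PEquiv.mem_trans _ _ _ _).2 ⟨b, (PEquiv.mem_iff_mem θ).1 hb, hc⟩⟩

theorem fg_univ [Finite V] : IsFGRightIdeal (Set.univ : Set (Arr V)) := by
  refine ⟨Set.range fun x : V => (⟨𝟙 x⟩ : Arr V), Set.finite_range _, ?_⟩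
  ext a
  simp only [Set.mem_univ, true_iff]
  exact ⟨_, ⟨a.cod, rfl⟩, a, id_isProd a⟩

/-- `R(C)` is an inverse monoid with zero when `C` is finitely aligned with finitely many
identities. The product `θ φ` is `θ ∘ φ`, the unit is the identity function on `C`, the zero is
the empty function. -/
instance [Finite V] [FinitelyAligned V] : InverseMonoidWithZero (R V) where
  mul θ φ := ⟨φ.1.trans θ.1, φ.2.1.trans θ.2.1, pdom_trans_fg φ.2.1 φ.2.2.2 θ.2.2.1, by
    have := pdom_trans_fg θ.2.1.symm (by simpa using θ.2.2.1) φ.2.2.2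
    rwa [← PEquiv.symm_trans_rev] at this⟩
  one := ⟨PEquiv.refl _, by
    intro r s t r' hp hr
    obtain rfl : r = r' := by simpa using hr
    exact ⟨t, by simp, hp⟩, by
    convert fg_univ (V := V)
    ext a
    simp [pdom], by
    convert fg_univ (V := V)
    ext a
    simp [pdom]⟩
  zero := ⟨⊥, by
    intro r s t r' hp hr
    exact absurd hr (by simp), ⟨∅, Set.finite_empty, by ext; simp [pdom, rightIdeal]⟩,
    ⟨∅, Set.finite_empty, by ext; simp [pdom, rightIdeal]⟩⟩
  inv θ := ⟨θ.1.symm, θ.2.1.symm, θ.2.2.2, by simpa using θ.2.2.1⟩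
  mul_assoc θ φ ψ := Subtype.ext (PEquiv.trans_assoc ψ.1 φ.1 θ.1).symm
  one_mul θ := Subtype.ext (PEquiv.trans_refl θ.1)
  mul_one θ := Subtype.ext (PEquiv.refl_trans θ.1)
  zero_mul θ := Subtype.ext (PEquiv.trans_bot θ.1)
  mul_zero θ := Subtype.ext (PEquiv.bot_trans θ.1)
  mul_inv_mul := by
    rintro ⟨θ, hθ⟩
    refine Subtype.ext ?_
    change θ.trans (θ.symm.trans θ) = θ
    ext a b
    simp only [← Option.mem_def]
    simp only [PEquiv.mem_trans, PEquiv.mem_iff_mem]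
    constructor
    · rintro ⟨c, h1, d, h2, h3⟩
      obtain rfl := PEquiv.inj θ h1 h2
      exact h3
    · intro h
      exact ⟨b, h, a, h, h⟩
  inv_mul_inv := by
    rintro ⟨θ, hθ⟩
    refine Subtype.ext ?_
    change θ.symm.trans (θ.trans θ.symm) = θ.symm
    ext a b
    simp only [← Option.mem_def]
    simp only [PEquiv.mem_trans, PEquiv.mem_iff_mem]
    constructor
    · rintro ⟨c, h1, d, h2, h3⟩
      obtain rfl := Option.mem_unique h1 h2
      exact h3
    · intro h
      exact ⟨b, h, a, h, h⟩
  inv_unique := by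
    rintro ⟨θ, hθ⟩ ⟨φ, hφ⟩ h1 h2
    have h1 : θ.trans (φ.trans θ) = θ := congrArg Subtype.val h1
    have h2 : φ.trans (θ.trans φ) = φ := congrArg Subtype.val h2
    refine Subtype.ext ?_
    change φ = θ.symm
    ext x y
    simp only [← Option.mem_def]
    rw [PEquiv.mem_iff_mem]
    constructor
    · intro h
      have h' := h
      rw [← h2] at h'
      simp only [PEquiv.mem_trans] at h'
      obtain ⟨c, hc, d, hd, he⟩ := h'
      obtain rfl := Option.mem_unique h hc
      obtain rfl := PEquiv.inj φ h he
      exact hd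
    · intro h
      have h' := h
      rw [← h1] at h'
      simp only [PEquiv.mem_trans] at h'
      obtain ⟨c, hc, d, hd, he⟩ := h'
      obtain rfl := Option.mem_unique h hc
      obtain rfl := PEquiv.inj θ h he
      exact hd

variable (V) in
/-- `B(C) = R(C)/≡`. -/
abbrev B [Finite V] [FinitelyAligned V] : Type (max u v) := LenzQuotient (R V)

/-! ### Higher rank graphs -/

/-- The degree of an arrow under a functor to the monoid `ℕ^k`, viewed as a category with one
object. -/
def degree {k : ℕ} (d : V ⥤ SingleObj (Multiplicative (Fin k → ℕ))) (a : Arr V) : Fin k → ℕ :=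
  Multiplicative.toAdd (show Multiplicative (Fin k → ℕ) from d.map a.hom)

/-- `d` makes the category a higher rank graph (a `k`-graph): the category is countable and the
degree map `d` has the unique factorization property. -/
structure IsHigherRankGraph {k : ℕ} (d : V ⥤ SingleObj (Multiplicative (Fin k → ℕ))) : Prop where
  countable : Countable (Arr V)
  ufp : ∀ (a : Arr V) (m n : Fin k → ℕ), degree d a = m + n →
    ∃! p : Arr V × Arr V, IsProd p.1 p.2 a ∧ degree d p.1 = m ∧ degree d p.2 = n

/-- Every identity `e` is the codomain of an arrow of each degree. -/
def NoSources {k : ℕ} (d : V ⥤ SingleObj (Multiplicative (Fin k → ℕ))) : Prop :=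
  ∀ (e : V) (m : Fin k → ℕ), ∃ x : Arr V, x.cod = e ∧ degree d x = m

/-- For each identity `e` only finitely many elements of `eC` have a given degree. -/
def RowFinite {k : ℕ} (d : V ⥤ SingleObj (Multiplicative (Fin k → ℕ))) : Prop :=
  ∀ (e : V) (m : Fin k → ℕ), {x : Arr V | x.cod = e ∧ degree d x = m}.Finite

variable (V) in
/-- For all `a ≠ b` with the same domain there is `u` such that `au` and `bu` are (defined and)
incomparable. -/
def Aperiodic : Prop :=
  ∀ a b : Arr V, a ≠ b → a.dom = b.dom →
    ∃ u au bu : Arr V, IsProd a u au ∧ IsProd b u bu ∧ Independent au bu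

end Arrows

end HigherRank

/-! Elements of R(C) are partial injections of the set of arrows, so everything is computed on
graphs. The order is restriction (`natLE_iff`), idempotents are partial identities, and `lenz_iff`
turns θ ≡ φ into a density statement: every r where one of them is defined has an extension ru at
which the two agree.

Aperiodic implies fundamental: suppose the class of θ commutes with idempotents and θ(r) = r' ≠ r.
Pick u with r'u and ru independent. Commutation with the identity on ruC forces some extension of
r'u = θ(ru) into ruC, a contradiction; hence θ is a partial identity.

Fundamental implies aperiodic: if no u separates a ≠ b, let θ send bs to as. Since aw and bw always
have a common extension, the class of θ commutes with every idempotent, so it is idempotent. Then θ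
fixes some bw, that is aw = bw, and right cancellation gives a = b. Unique factorization enters
through left cancellation (θ is well defined and injective) and right cancellation. -/

namespace HigherRank

/-! ### Classes and idempotents modulo the Lenz congruence. -/

section LenzQuotient

variable {S : Type*} [InverseMonoidWithZero S]

/-- The class of an element modulo the Lenz congruence. -/
def lenzMk (s : S) : LenzQuotient S := ((s : S) : (lenzCon S).Quotient)

theorem lenzMk_surjective : Function.Surjective (lenzMk : S → LenzQuotient S) :=
  Quotient.mk''_surjective

theorem lenzMk_eq_iff {s t : S} : lenzMk s = lenzMk t ↔ Lenz s t :=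
  (lenzCon S).eq

theorem lenzMk_mul (s t : S) : lenzMk (s * t) = lenzMk s * lenzMk t := rfl

theorem lenzMk_inv (s : S) : lenzMk s⁻¹ = (lenzMk s)⁻¹ := rfl

/-- Idempotents lift along the quotient by the Lenz congruence. -/
theorem exists_lenzMk_eq_of_isIdempotentElem {e : LenzQuotient S} (he : IsIdempotentElem e) :
    ∃ f : S, f * f = f ∧ lenzMk f = e := by
  obtain ⟨s, rfl⟩ := lenzMk_surjective e
  -- The representative `s` need not be idempotent, but `s * s⁻¹` is, and its class is `e * e⁻¹ = e
  -- * e = e`.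
  refine ⟨s * s⁻¹, idem_mul_inv s, ?_⟩
  rw [lenzMk_mul, lenzMk_inv, inv_of_idem he, he]

end LenzQuotient

/-! ### Products of arrows and independence. -/

section Arrows

universe v u

variable {V : Type u} [Category.{v} V]

theorem IsProd.assoc_symm {a b c bc abc : Arr V} (h : IsProd b c bc) (h' : IsProd a bc abc) :
    ∃ ab, IsProd a b ab ∧ IsProd ab c abc := by
  cases h with
  | mk g k =>
    cases h' with
    | mk f _ =>
      refine ⟨_, .mk f g, ?_⟩
      rw [Category.assoc]
      exact .mk (g ≫ f) k

theorem IsProd.dom_right {a b c : Arr V} (h : IsProd a b c) : c.dom = b.dom := by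
  cases h; rfl

theorem mem_rightIdeal_singleton {a c : Arr V} : c ∈ rightIdeal {a} ↔ ∃ s, IsProd a s c := by
  simp [rightIdeal]

theorem rightIdeal_mul_mem {X : Set (Arr V)} {a s c : Arr V} (ha : a ∈ rightIdeal X)
    (h : IsProd a s c) : c ∈ rightIdeal X := by
  obtain ⟨x, hx, t, ht⟩ := ha
  obtain ⟨w, -, hw⟩ := ht.assoc h
  exact ⟨x, hx, w, hw⟩

theorem not_independent_iff {a b : Arr V} :
    ¬ Independent a b ↔ ∃ c s t, IsProd a s c ∧ IsProd b t c := by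
  rw [Independent, ← Ne, ← Set.nonempty_iff_ne_empty]
  simp only [Set.Nonempty, Set.mem_inter_iff, mem_rightIdeal_singleton]
  exact ⟨fun ⟨c, ⟨s, hs⟩, t, ht⟩ => ⟨c, s, t, hs, ht⟩, fun ⟨c, s, t, hs, ht⟩ => ⟨c, ⟨s, hs⟩, t, ht⟩⟩

/-! ### The elements of R(C) used as tests: identities on aC and shifts bC → aC. -/

open Classical in
/-- The identity function on the principal right ideal `aC`. -/
noncomputable def principalIdem (a : Arr V) : R V :=
  ⟨PEquiv.ofSet (rightIdeal {a}), by
    intro r s t r' hp hr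
    obtain ⟨rfl, hr'⟩ := PEquiv.mem_ofSet_iff.1 hr
    exact ⟨t, PEquiv.mem_ofSet_iff.2 ⟨rfl, rightIdeal_mul_mem hr' hp⟩, hp⟩,
    ⟨{a}, Set.finite_singleton a, by ext; simp [pdom]⟩,
    ⟨{a}, Set.finite_singleton a, by ext; simp [pdom]⟩⟩

open Classical in
theorem mem_principalIdem {a x y : Arr V} :
    y ∈ (principalIdem a).1 x ↔ y = x ∧ ∃ s, IsProd a s x := by
  rw [← mem_rightIdeal_singleton]
  refine PEquiv.mem_ofSet_iff.trans ⟨?_, ?_⟩ <;> rintro ⟨rfl, h⟩ <;> exact ⟨rfl, h⟩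

theorem mem_principalIdem_of_isProd {a s x : Arr V} (h : IsProd a s x) :
    x ∈ (principalIdem a).1 x :=
  mem_principalIdem.2 ⟨rfl, s, h⟩

variable (V) in
/-- `as = at` implies `s = t`. -/
def LeftCancellative : Prop := ∀ a s t c : Arr V, IsProd a s c → IsProd a t c → s = t

open Classical in
/-- The function `bC → aC` that sends `bs` to `as`. -/
noncomputable def shiftPEquiv (hV : LeftCancellative V) (a b : Arr V) :
    PEquiv (Arr V) (Arr V) where
  toFun x := if h : ∃ y s, IsProd b s x ∧ IsProd a s y then some h.choose else none
  invFun y := if h : ∃ x s, IsProd b s x ∧ IsProd a s y then some h.choose else none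
  inv x y := by
    simp only [Option.dite_none_right_eq_some, Option.some.injEq]
    constructor
    · rintro ⟨h, rfl⟩
      obtain ⟨s, h1, h2⟩ := h.choose_spec
      have h' : ∃ z t, IsProd b t h.choose ∧ IsProd a t z := ⟨y, s, h1, h2⟩
      refine ⟨h', ?_⟩
      obtain ⟨t, h3, h4⟩ := h'.choose_spec
      -- Cancelling `b` shows that the chosen value does not depend on the factor `s`; cancelling
      -- `a` does the same for the inverse function.
      obtain rfl := hV _ _ _ _ h1 h3
      exact h4.unique h2
    · rintro ⟨h, rfl⟩
      obtain ⟨s, h1, h2⟩ := h.choose_spec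
      have h' : ∃ z t, IsProd b t z ∧ IsProd a t h.choose := ⟨x, s, h1, h2⟩
      refine ⟨h', ?_⟩
      obtain ⟨t, h3, h4⟩ := h'.choose_spec
      obtain rfl := hV _ _ _ _ h2 h4
      exact h3.unique h1

open Classical in
theorem mem_shiftPEquiv {hV : LeftCancellative V} {a b x y : Arr V} :
    y ∈ shiftPEquiv hV a b x ↔ ∃ s, IsProd b s x ∧ IsProd a s y := by
  change (dite _ _ _ = some y) ↔ _
  simp only [Option.dite_none_right_eq_some, Option.some.injEq]
  constructor
  · rintro ⟨h, rfl⟩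
    exact h.choose_spec
  · rintro ⟨s, h1, h2⟩
    have h : ∃ z t, IsProd b t x ∧ IsProd a t z := ⟨y, s, h1, h2⟩
    refine ⟨h, ?_⟩
    obtain ⟨t, h3, h4⟩ := h.choose_spec
    obtain rfl := hV _ _ _ _ h1 h3
    exact h4.unique h2

/-- The element of `R(C)` that maps `bC` onto `aC` by sending `bs` to `as`. -/
noncomputable def shift (hV : LeftCancellative V) (a b : Arr V) (hab : a.dom = b.dom) : R V :=
  ⟨shiftPEquiv hV a b, by
    intro r s t r' hp hr
    obtain ⟨w, h1, h2⟩ := mem_shiftPEquiv.1 hr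
    -- With r = bw, the product rs is b(ws), which goes to a(ws) = (aw)s.
    obtain ⟨ws, h3, h4⟩ := h1.assoc hp
    obtain ⟨t', h5⟩ := exists_isProd (a := a) (b := ws) (hab.trans h4.dom_eq)
    refine ⟨t', mem_shiftPEquiv.2 ⟨ws, h4, h5⟩, ?_⟩
    obtain ⟨r'', h6, h7⟩ := h3.assoc_symm h5
    rwa [h2.unique h6],
    ⟨{b}, Set.finite_singleton b, by
      ext x
      simp only [pdom, Set.mem_ofPred_eq, mem_shiftPEquiv, mem_rightIdeal_singleton]
      constructor
      · rintro ⟨y, s, h, -⟩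
        exact ⟨s, h⟩
      · rintro ⟨s, h⟩
        obtain ⟨y, hy⟩ := exists_isProd (hab.trans h.dom_eq)
        exact ⟨y, s, h, hy⟩⟩,
    ⟨{a}, Set.finite_singleton a, by
      ext y
      simp only [pdom, Set.mem_ofPred_eq, PEquiv.mem_iff_mem, mem_shiftPEquiv,
        mem_rightIdeal_singleton]
      constructor
      · rintro ⟨x, s, -, h⟩
        exact ⟨s, h⟩
      · rintro ⟨s, h⟩
        obtain ⟨x, hx⟩ := exists_isProd (hab.symm.trans h.dom_eq)
        exact ⟨x, s, hx, h⟩⟩⟩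

theorem mem_shift {hV : LeftCancellative V} {a b x y : Arr V} {hab : a.dom = b.dom} :
    y ∈ (shift hV a b hab).1 x ↔ ∃ s, IsProd b s x ∧ IsProd a s y :=
  mem_shiftPEquiv (hV := hV)

theorem R.ext_mem {θ φ : R V} (h : ∀ x y, y ∈ θ.1 x ↔ y ∈ φ.1 x) : θ = φ :=
  Subtype.ext (PEquiv.ext fun x => Option.ext fun y => h x y)

/-! ### Order, idempotents and the Lenz relation of R(C) in terms of arrows. -/

section InverseMonoid

variable [Finite V] [FinitelyAligned V]

theorem mem_mul {θ φ : R V} {x y : Arr V} :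
    y ∈ (θ * φ).1 x ↔ ∃ w, w ∈ φ.1 x ∧ y ∈ θ.1 w :=
  PEquiv.mem_trans φ.1 θ.1 x y

theorem mem_inv {θ : R V} {x y : Arr V} : y ∈ (θ⁻¹).1 x ↔ x ∈ θ.1 y :=
  PEquiv.mem_iff_mem θ.1

theorem ne_zero_iff {θ : R V} : θ ≠ 0 ↔ ∃ x y, y ∈ θ.1 x := by
  constructor
  · intro h
    by_contra! hn
    refine h (R.ext_mem fun x y => ⟨fun hy => absurd hy (hn x y), fun hy => ?_⟩)
    exact absurd hy (Option.not_mem_none y)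
  · rintro ⟨x, y, h⟩ rfl
    exact absurd h (Option.not_mem_none y)

theorem natLE_iff {θ φ : R V} : NatLE θ φ ↔ ∀ x y, y ∈ θ.1 x → y ∈ φ.1 x := by
  constructor
  · intro h x y hy
    rw [h] at hy
    obtain ⟨w, hw, hy⟩ := mem_mul.1 hy
    obtain ⟨z, hz, hy⟩ := mem_mul.1 hy
    obtain rfl := PEquiv.inj θ.1 hw (mem_inv.1 hz)
    exact hy
  · intro h
    refine R.ext_mem fun x y => ⟨fun hy => ?_, fun hy => ?_⟩
    · exact mem_mul.2 ⟨y, hy, mem_mul.2 ⟨x, mem_inv.2 hy, h x y hy⟩⟩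
    · obtain ⟨w, hw, hy⟩ := mem_mul.1 hy
      obtain ⟨z, hz, hy⟩ := mem_mul.1 hy
      obtain rfl := PEquiv.inj θ.1 hw (mem_inv.1 hz)
      rwa [Option.mem_unique hy (h _ _ hw)]

/-- If f(x) = y, idempotency gives f(y) = y as well, and f is injective. -/
theorem eq_of_mem_idem {f : R V} (hf : f * f = f) {x y : Arr V} (h : y ∈ f.1 x) : y = x := by
  have h' := h
  rw [← hf] at h'
  obtain ⟨w, hw, hy⟩ := mem_mul.1 h'
  obtain rfl := Option.mem_unique h hw
  exact PEquiv.inj f.1 hy h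

theorem mul_self_of_forall_eq {f : R V} (hf : ∀ x y, y ∈ f.1 x → y = x) : f * f = f := by
  refine R.ext_mem fun x y => ⟨fun h => ?_, fun h => ?_⟩
  · obtain ⟨w, hw, hy⟩ := mem_mul.1 h
    obtain rfl := hf _ _ hw
    exact hy
  · obtain rfl := hf _ _ h
    exact mem_mul.2 ⟨y, h, h⟩

theorem principalIdem_mul_self (a : Arr V) : principalIdem a * principalIdem a = principalIdem a :=
  mul_self_of_forall_eq fun _ _ h => (mem_principalIdem.1 h).1

/-- One half of the Lenz relation, in terms of arrows. -/
theorem lenz_half_iff {θ φ : R V} :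
    (∀ x : R V, x ≠ 0 → NatLE x θ → ∃ z : R V, z ≠ 0 ∧ NatLE z x ∧ NatLE z φ) ↔
      ∀ r r', r' ∈ θ.1 r → ∃ u q q', IsProd r u q ∧ q' ∈ θ.1 q ∧ q' ∈ φ.1 q := by
  constructor
  · intro h r r' hr
    -- The test element below `θ` is its restriction to rC: a non-zero element below it is defined
    -- at some extension of `r`.
    have hx : ∀ x y, y ∈ (θ * principalIdem r).1 x ↔ (∃ s, IsProd r s x) ∧ y ∈ θ.1 x := by
      intro x y
      rw [mem_mul]
      constructor
      · rintro ⟨w, hw, hy⟩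
        obtain ⟨rfl, hs⟩ := mem_principalIdem.1 hw
        exact ⟨hs, hy⟩
      · rintro ⟨hs, hy⟩
        exact ⟨x, mem_principalIdem.2 ⟨rfl, hs⟩, hy⟩
    obtain ⟨z, hz, hzx, hzφ⟩ := h (θ * principalIdem r)
      (ne_zero_iff.2 ⟨r, r', (hx _ _).2 ⟨⟨_, isProd_id r⟩, hr⟩⟩)
      (natLE_iff.2 fun x y hy => ((hx x y).1 hy).2)
    obtain ⟨q, q', hq⟩ := ne_zero_iff.1 hz
    obtain ⟨⟨u, hu⟩, hqθ⟩ := (hx _ _).1 (natLE_iff.1 hzx _ _ hq)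
    exact ⟨u, q, q', hu, hqθ, natLE_iff.1 hzφ _ _ hq⟩
  · intro h x hx hxθ
    obtain ⟨r, r', hr⟩ := ne_zero_iff.1 hx
    obtain ⟨u, q, q', hu, hqθ, hqφ⟩ := h r r' (natLE_iff.1 hxθ _ _ hr)
    obtain ⟨q'', hqx, -⟩ := x.2.1 r u q r' hu hr
    obtain rfl := Option.mem_unique hqθ (natLE_iff.1 hxθ _ _ hqx)
    -- As `x` and `φ` both send `q` to `q'`, they agree on all of qC, so the restriction of `φ` to
    -- qC lies below both.
    refine ⟨φ * principalIdem q, ?_, ?_, ?_⟩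
    · exact ne_zero_iff.2 ⟨q, q', mem_mul.2 ⟨q, mem_principalIdem_of_isProd (isProd_id q), hqφ⟩⟩
    · refine natLE_iff.2 fun p p' hp => ?_
      obtain ⟨w, hw, hp'⟩ := mem_mul.1 hp
      obtain ⟨rfl, s, hs⟩ := mem_principalIdem.1 hw
      obtain ⟨p1, h1, h2⟩ := φ.2.1 q s w q' hs hqφ
      obtain ⟨p2, h3, h4⟩ := x.2.1 q s w q' hs hqx
      obtain rfl := Option.mem_unique hp' h1
      rwa [h2.unique h4]
    · exact natLE_of_eq_mul_idem (principalIdem_mul_self q) rfl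

theorem lenz_iff {θ φ : R V} : Lenz θ φ ↔
    (∀ r r', r' ∈ θ.1 r → ∃ u q q', IsProd r u q ∧ q' ∈ θ.1 q ∧ q' ∈ φ.1 q) ∧
    (∀ r r', r' ∈ φ.1 r → ∃ u q q', IsProd r u q ∧ q' ∈ φ.1 q ∧ q' ∈ θ.1 q) :=
  and_congr lenz_half_iff lenz_half_iff

/-! ### The two implications. -/

/-- Aperiodicity makes `B(C)` fundamental, for any finitely aligned category with finitely many
identities. -/
theorem isFundamental_of_aperiodic (h : Aperiodic V) : IsFundamental (B V) := by
  intro a ha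
  obtain ⟨θ, rfl⟩ := lenzMk_surjective a
  -- The representative itself turns out to be idempotent, not only its class.
  suffices hθ : θ * θ = θ from congrArg lenzMk hθ
  refine mul_self_of_forall_eq fun r r' hr => ?_
  by_contra hne
  obtain ⟨u, a, b, ha', hb, hind⟩ := h r' r hne (θ.2.1.dom_eq hr)
  -- Here b = ru and a = r'u = θ(b), and the test idempotent is the identity on bC. Where the two
  -- products agree, at some bw, the value θ(bw) = aw must lie in bC.
  have hcomm : lenzMk (θ * principalIdem b) = lenzMk (principalIdem b * θ) :=
    ha (lenzMk (principalIdem b)) (congrArg lenzMk (principalIdem_mul_self b))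
  obtain ⟨a', hab, ha''⟩ := θ.2.1 r u b r' hb hr
  obtain rfl := ha'.unique ha''
  obtain ⟨w, q, q', hw, h1, h2⟩ := (lenz_iff.1 (lenzMk_eq_iff.1 hcomm)).1 b a
    (mem_mul.2 ⟨b, mem_principalIdem_of_isProd (isProd_id b), hab⟩)
  obtain ⟨p, hp, hp'⟩ := mem_mul.1 h2
  obtain ⟨rfl, t, ht⟩ := mem_principalIdem.1 hp'
  obtain ⟨p', hp1, hp2⟩ := θ.2.1 b w q a hw hab
  obtain rfl := Option.mem_unique hp hp1
  exact not_independent_iff.2 ⟨_, w, t, hp2, ht⟩ hind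

/-- If `B(C)` is fundamental and `C` is cancellative, then `C` is aperiodic. -/
theorem aperiodic_of_isFundamental (hl : LeftCancellative V)
    (hr : ∀ a b s c : Arr V, IsProd a s c → IsProd b s c → a = b)
    (h : IsFundamental (B V)) : Aperiodic V := by
  intro a b hne hab
  by_contra! hdep
  have hmeet : ∀ {w aw bw : Arr V}, IsProd a w aw → IsProd b w bw →
      ∃ c s t, IsProd aw s c ∧ IsProd bw t c := fun h1 h2 =>
    not_independent_iff.1 (hdep _ _ _ h1 h2)
  set θ := shift hl a b hab with hθ
  have hidem : IsIdempotentElem (lenzMk θ) := by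
    refine h _ fun e he => ?_
    obtain ⟨f, hf, rfl⟩ := exists_lenzMk_eq_of_isIdempotentElem he
    -- The fixed arrows of `f` form a right ideal.
    have hmul : ∀ {x s c : Arr V}, x ∈ f.1 x → IsProd x s c → c ∈ f.1 c := by
      intro x s c hx hc
      obtain ⟨c', hc', -⟩ := f.2.1 x s c x hc hx
      rwa [eq_of_mem_idem hf hc'] at hc'
    refine lenzMk_eq_iff.2 (lenz_iff.2 ⟨fun r r' hr => ?_, fun r r' hr => ?_⟩)
    · obtain ⟨r1, h1, h2⟩ := mem_mul.1 hr
      obtain rfl := eq_of_mem_idem hf h1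
      obtain ⟨w, hb, ha⟩ := mem_shift.1 h2
      -- Here `r1` = bw is fixed by `f` and c = aws = bwt. At q = bws the value of `θ` is `c`; both
      -- `q` and `c` extend `r1`, so `f` fixes them and the two products agree at `q`.
      obtain ⟨c, s, t, hs, ht⟩ := hmeet ha hb
      obtain ⟨q, hq⟩ := exists_isProd (a := r1) (b := s)
        (by rw [hb.dom_right, ← ha.dom_right, hs.dom_eq])
      obtain ⟨c', hc', hc''⟩ := θ.2.1 r1 s q r' hq h2
      obtain rfl := hs.unique hc''
      exact ⟨s, q, c, hq, mem_mul.2 ⟨q, hmul h1 hq, hc'⟩, mem_mul.2 ⟨c, hc', hmul h1 ht⟩⟩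
    · obtain ⟨r1, h2, h1⟩ := mem_mul.1 hr
      obtain rfl := eq_of_mem_idem hf h1
      -- Now `f` fixes aw instead, and the point of agreement is c = aws = bwt itself: both `c` and
      -- θ(c) = awt extend aw, so `f` fixes them.
      obtain ⟨w, hb, ha⟩ := mem_shift.1 h2
      obtain ⟨c, s, t, hs, ht⟩ := hmeet ha hb
      obtain ⟨c', hc', hc''⟩ := θ.2.1 r t c r' ht h2
      exact ⟨t, c, c', ht, mem_mul.2 ⟨c', hc', hmul h1 hc''⟩, mem_mul.2 ⟨c, hmul h1 hs, hc'⟩⟩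
  obtain ⟨f, hf, hfθ⟩ := exists_lenzMk_eq_of_isIdempotentElem hidem
  -- Since θ(b) = a and θ ≡ f with `f` a partial identity, `θ` fixes some extension of `b`.
  obtain ⟨u, q, q', -, h1, h2⟩ := (lenz_iff.1 (lenzMk_eq_iff.1 hfθ)).2 b a
    (mem_shift.2 ⟨_, isProd_id b, by rw [← hab]; exact isProd_id a⟩)
  obtain rfl := eq_of_mem_idem hf h2
  obtain ⟨w, hb, ha⟩ := mem_shift.1 h1
  exact hne (hr a b w _ ha hb)

end InverseMonoid

/-! ### Degrees and cancellation in higher rank graphs. -/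

section HigherRankGraph

variable {k : ℕ} {d : V ⥤ SingleObj (Multiplicative (Fin k → ℕ))}

theorem degree_of_isProd {a b c : Arr V} (h : IsProd a b c) :
    degree d c = degree d a + degree d b := by
  cases h with
  | mk f g =>
    change Multiplicative.toAdd (show Multiplicative (Fin k → ℕ) from d.map (g ≫ f)) = _
    rw [d.map_comp]
    -- Composition in `SingleObj` is multiplication in reverse order, which undoes the reversal in
    -- `g ≫ f`.
    rfl

/-- Degrees add and ℕ^k is cancellative, so (a, s) and (a, t) factor the same arrow with the same
pair of degrees; unique factorization identifies them. -/
theorem IsHigherRankGraph.leftCancellative (hC : IsHigherRankGraph d) : LeftCancellative V := by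
  intro a s t c hs ht
  have h := (degree_of_isProd (d := d) hs).symm.trans (degree_of_isProd ht)
  have hst : degree d t = degree d s := (add_left_cancel h).symm
  exact congrArg Prod.snd ((hC.ufp c _ _ (degree_of_isProd hs)).unique
    (y₁ := (a, s)) (y₂ := (a, t)) ⟨hs, rfl, rfl⟩ ⟨ht, rfl, hst⟩)

theorem IsHigherRankGraph.rightCancellative (hC : IsHigherRankGraph d) {a b s c : Arr V}
    (ha : IsProd a s c) (hb : IsProd b s c) : a = b := by
  have h := (degree_of_isProd (d := d) ha).symm.trans (degree_of_isProd hb)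
  have hab : degree d b = degree d a := (add_right_cancel h).symm
  exact congrArg Prod.fst ((hC.ufp c _ _ (degree_of_isProd ha)).unique
    (y₁ := (a, s)) (y₂ := (b, s)) ⟨ha, rfl, rfl⟩ ⟨hb, hab, rfl⟩)

end HigherRankGraph

end Arrows

end HigherRank

theorem mainTheorem4 {V : Type*} [CategoryTheory.Category V] [Finite V]
    [HigherRank.StronglyFinitelyAligned V] {k : ℕ}
    (d : CategoryTheory.Functor V (CategoryTheory.SingleObj (Multiplicative (Fin k → ℕ))))
    (hC : HigherRank.IsHigherRankGraph d) (hns : HigherRank.NoSources d)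
    (hrf : HigherRank.RowFinite d) :
    HigherRank.IsFundamental (HigherRank.B V) ↔ HigherRank.Aperiodic V :=
  ⟨HigherRank.aperiodic_of_isFundamental hC.leftCancellative
    fun _ _ _ _ => hC.rightCancellative, HigherRank.isFundamental_of_aperiodic⟩
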